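/- Let $n\ge 1$, let $u\in S_n$, and let $\beta=(i_1,\dots,i_k)\in[n-1]^k$ be a braid word some subword of which is a reduced word of $u$. Let $\ell$ be the length on $S_n$, $s_i=(i\ \,i{+}1)$, and $v\lhd s_i=vs_i$ if $\ell(vs_i)<\ell(v)$, $v\lhd s_i=v$ otherwise. Put $u_k=u$, $u_{j-1}=u_j\lhd s_{i_j}$. **3D plabic graph $G_{u,\beta}$.** Draw $n$ horizontal strands, in positions $1,\dots,n$ from bottom to top. From left to right, for $j=1,\dots,k$: if $u_j=u_{j-1}$, draw a bridge between the strands in positions $i_j$ and $i_j+1$; otherwise draw a crossing of these two strands, in which the strand going up (from left to right) passes over the other one. The region at level $l$ is the one between positions $l$ and $l+1$; the $n-1$ regions at the left border are the boundary regions. **Soap films.** Each bridge $d$ has a soap film $C_d$. It starts at $d$ as the region immediately to the left of $d$ between the two strands joined by $d$, and continues to the left, staying attached to these strands, also when they move at crossings; the strands lying between the two strands to which a piece of film is attached are passed over or under by the film. (If the upper end of a piece is attached to the lower strand of a crossing and is carried upwards, as one moves left, past the upper strand, then the film passes under the latter; if its lower end is attached to the upper strand of a crossing and is carried downwards past the lower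 strand, then the film passes over the latter.) When a piece of film covering the region immediately to the right of another bridge reaches that bridge, it is unchanged if it passes over the top strand or under the bottom strand of the bridge; otherwise the part between the two strands of the bridge is cut out, and the parts below the bottom strand and above the top strand, if any, continue, attached to these strands. The bridge $d$ is *frozen* if $C_d$ covers some boundary region and *mutable* otherwise. Let $m$ and $f$ be the numbers of mutable and frozen bridges, and list the soap films as $C_1,\dots,C_{m+f}$: first those of the mutable bridges, from left to right, then those of the frozen bridges, from left to right. **Matrices.** Around each bridge let $L,R,U,D$ be the regions to its left, to its right, above and below, and draw six half arrows: $L\to R$ (twice), $R\to U$, $U\to L$, $R\to D$, $D\to L$. Each half arrow $X\to Y$ gives one half arrow $x\to y$ for every pair of soap films with $C_x$ covering $X$ and $C_y$ covering $Y$. Let $$b_{x,y}=\tfrac12\bigl(\#\{\text{half arrows }x\to y\}-\#\{\text{half arrows }y\to x\}\bigr).$$ These are the signed numbers of arrows of the quiver $Q_{u,\beta}$. The extended exchange matrix is $\widetilde B(Q_{u,\beta})=(b_{x,y})_{1\le x\le m,\,1\le y\le m+f}$, and the half arrow matrix is $H^{u,\beta}=(b_{x,y})_{1\le x,y\le m+f}$.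 Let $\partial(C_x)\in\mathbb Z^{n-1}$ be the vector whose $l$-th coordinate is $1$ if $C_x$ covers the $l$-th boundary region and $0$ otherwise; let $(a,b)=a^TMb$, where $M$ is $-\tfrac12$ times the Cartan matrix of type $A_{n-1}$; let $D^{u,\beta}=\bigl((\partial(C_x),\partial(C_y))\bigr)_{1\le x,y\le m+f}$ and $\widehat{B}^{u,\beta}=H^{u,\beta}+D^{u,\beta}$. **Statement.** The matrix $\widetilde B(Q_{u,\beta})$ has integer entries, the matrix $\widehat{B}^{u,\beta}$ is invertible, and, with $A^{u,\beta}=(\widehat{B}^{u,\beta})^{-1}$, the group $$\ker \widetilde B(Q_{u,\beta})=\{v\in\mathbb Z^{m+f}:\ \widetilde B(Q_{u,\beta})\,v=0\}$$ is a free abelian group of rank $f$, with basis the last $f$ columns $\mathrm{col}_j(A^{u,\beta})$, $m+1\le j\le m+f$, of $A^{u,\beta}$ (in particular these columns have integer entries). -/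

import Mathlib

/-! Braid words on `r + 1` strands, their 3D plabic graphs, soap films, half-arrow quivers and the
matrices attached to them.

Everything is indexed from zero.  Strand positions are `Fin (r + 1)`, counted from the bottom of the
picture; the letter `i : Fin r` is the generator exchanging the positions `i` and `i + 1`.  A braid
word of length `k` has letters numbered `0, ..., k - 1` from left to right and `k + 1` vertical
slices: slice `j` lies immediately to the left of letter `j`, and slice `j + 1` immediately to the
right of it.  Slice `0` is the left border.  The level `l` of a slice is the interval between the
strands in positions `l` and `l + 1`. -/

noncomputable section

namespace BraidVariety

open scoped Matrix Classical

variable {r : ℕ}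

/-- The simple transposition exchanging `i` and `i + 1`. -/
def simpleTransposition (i : Fin r) : Equiv.Perm (Fin (r + 1)) :=
  Equiv.swap i.castSucc i.succ

/-- The permutation represented by a word in the simple transpositions. -/
def wordPerm (L : List (Fin r)) : Equiv.Perm (Fin (r + 1)) :=
  (L.map simpleTransposition).prod

/-- The length of a permutation: the smallest length of a word representing it. -/
def permLength (v : Equiv.Perm (Fin (r + 1))) : ℕ :=
  sInf {k | ∃ L : List (Fin r), wordPerm L = v ∧ L.length = k}

/-- `L` is a reduced word of `v`. -/
def IsReducedWord (L : List (Fin r)) (v : Equiv.Perm (Fin (r + 1))) : Prop :=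
  wordPerm L = v ∧ L.length = permLength v

/-- The Demazure quotient of `v` by the simple transposition `i`. -/
def demazureQuotient (v : Equiv.Perm (Fin (r + 1))) (i : Fin r) : Equiv.Perm (Fin (r + 1)) :=
  if permLength (v * simpleTransposition i) < permLength v then v * simpleTransposition i else v

/-- The permutation at the leftmost slice of the word `β`, when it is `u` at the rightmost one. -/
def leftPerm (u : Equiv.Perm (Fin (r + 1))) (β : List (Fin r)) : Equiv.Perm (Fin (r + 1)) :=
  β.foldr (fun i v => demazureQuotient v i) u

/-- The permutation `u_j` at slice `j`: it is `u` at the last slice, and reading a letter from right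
to left replaces it by the Demazure quotient.  It sends a position to the strand which is
in that position; strands are named by their position at the left border
when the permutation at slice `0` is trivial. -/
def slicePerm (u : Equiv.Perm (Fin (r + 1))) (β : List (Fin r)) (j : ℕ) :
    Equiv.Perm (Fin (r + 1)) :=
  leftPerm u (β.drop j)

/-- The letters drawn as bridges; all the other letters are drawn as positive crossings. -/
def bridges (u : Equiv.Perm (Fin (r + 1))) (β : List (Fin r)) : Finset (Fin β.length) :=
  Finset.univ.filter fun j => slicePerm u β (j + 1) = slicePerm u β j

/-- A piece of the section of a soap film by a vertical line.  It is attached to the strands `lower`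
and `upper`.  Among the strands located between these two, it passes over those which belong
to `overStrands`, and under the other ones. -/
structure Arc (r : ℕ) where
  lower : Fin (r + 1)
  upper : Fin (r + 1)
  overStrands : Finset (Fin (r + 1))

/-- In a slice where the strands are arranged by `v`, the arc covers level `l`. -/
def Arc.Covers (v : Equiv.Perm (Fin (r + 1))) (a : Arc r) (l : ℤ) : Prop :=
  ((v.symm a.lower : ℕ) : ℤ) ≤ l ∧ l < ((v.symm a.upper : ℕ) : ℤ)

/-- Moving an arc leftwards past a positive crossing of the strands in positions `i` and `i + 1`,
where `v` is the arrangement of the strands on the right of the crossing.  The strand `y` which is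
in position `i + 1` on the right comes from position `i` on the left, and it passes over the other
strand `x`.  The arc stays attached to its two strands.  If its upper end
is carried upwards by `x`, then it is carried under `y`; if its lower end is
carried downwards by `y`, then it is carried over `x`. -/
def Arc.passCrossing (v : Equiv.Perm (Fin (r + 1))) (i : Fin r) (a : Arc r) : Arc r :=
  let x := v i.castSucc
  let y := v i.succ
  if a.upper = x then { a with overStrands := a.overStrands.erase y }
  else if a.lower = y then { a with overStrands := insert x a.overStrands }
  else a

/-- Moving an arc leftwards past a bridge between the strands `b` (bottom) and `t` (top) in positions
`i` and `i + 1`.  An arc which does not reach the bridge, or passes over the top strand, or passes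
under the bottom strand, is unchanged.  Otherwise the part between `b` and `t` is cut out,
and what remains below `b` and above `t` is kept. -/
def Arc.passBridge (v : Equiv.Perm (Fin (r + 1))) (i : Fin r) (a : Arc r) : List (Arc r) :=
  let b := v i.castSucc
  let t := v i.succ
  if ¬ a.Covers v (i : ℕ) then [a]
  else if (a.upper ≠ t ∧ t ∈ a.overStrands) ∨ (a.lower ≠ b ∧ b ∉ a.overStrands) then [a]
  else (if a.lower ≠ b then [{ a with upper := b }] else []) ++
    (if a.upper ≠ t then [{ a with lower := t }] else [])

/-- The section, by the leftmost slice of `β`, of the soap film that starts at the letter number `d`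
of `β`.  (There is no soap film if that letter is a crossing.) -/
def leftFilm (u : Equiv.Perm (Fin (r + 1))) : List (Fin r) → ℕ → List (Arc r)
  | [], _ => []
  | i :: β, 0 =>
      let v := leftPerm u β
      if demazureQuotient v i = v then [⟨v i.castSucc, v i.succ, ∅⟩] else []
  | i :: β, d + 1 =>
      let v := leftPerm u β
      if demazureQuotient v i = v then (leftFilm u β d).flatMap (Arc.passBridge v i)
      else (leftFilm u β d).map (Arc.passCrossing v i)

/-- The soap film of the bridge `d` covers the region at level `l` of slice `j`.  A soap film lies
on the left of its bridge. -/
def FilmCovers (u : Equiv.Perm (Fin (r + 1))) (β : List (Fin r)) (d j : ℕ) (l : ℤ) : Prop :=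
  j ≤ d ∧ ∃ a ∈ leftFilm u (β.drop j) (d - j), a.Covers (slicePerm u β j) l

/-- The bridge `d` is frozen: its soap film is not closed and bounded, which means that it reaches a
boundary region. -/
def IsFrozen (u : Equiv.Perm (Fin (r + 1))) (β : List (Fin r)) (d : Fin β.length) : Prop :=
  ∃ l : Fin r, FilmCovers u β d 0 (l : ℕ)

/-- The frozen bridges. -/
def frozenBridges (u : Equiv.Perm (Fin (r + 1))) (β : List (Fin r)) : Finset (Fin β.length) :=
  (bridges u β).filter fun d => IsFrozen u β d

/-- The mutable bridges. -/
def mutableBridges (u : Equiv.Perm (Fin (r + 1))) (β : List (Fin r)) : Finset (Fin β.length) :=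
  (bridges u β).filter fun d => ¬ IsFrozen u β d

/-- The number `m` of mutable vertices. -/
def numMutable (u : Equiv.Perm (Fin (r + 1))) (β : List (Fin r)) : ℕ := (mutableBridges u β).card

/-- The number `f` of frozen vertices. -/
def numFrozen (u : Equiv.Perm (Fin (r + 1))) (β : List (Fin r)) : ℕ := (frozenBridges u β).card

/-- The enumeration of the bridges by `1, ..., m + f`: first the mutable bridges from left to right,
then the frozen bridges from left to right. -/
def vertex (u : Equiv.Perm (Fin (r + 1))) (β : List (Fin r)) :
    Fin (numMutable u β + numFrozen u β) → Fin β.length :=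
  Fin.addCases (fun i => (mutableBridges u β).orderEmbOfFin rfl i)
    (fun i => (frozenBridges u β).orderEmbOfFin rfl i)

/-- The four regions around a bridge. -/
inductive Side
  | left | right | above | below

/-- The soap film of `d` covers the given region around the bridge `j`. -/
def CoversSide (u : Equiv.Perm (Fin (r + 1))) (β : List (Fin r)) (d j : Fin β.length) :
    Side → Prop
  | .left => FilmCovers u β d j ((β.get j : ℕ) : ℤ)
  | .right => FilmCovers u β d (j + 1) ((β.get j : ℕ) : ℤ)
  | .above => FilmCovers u β d (j + 1) (((β.get j : ℕ) : ℤ) + 1)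
  | .below => FilmCovers u β d (j + 1) (((β.get j : ℕ) : ℤ) - 1)

/-- The six half arrows near a bridge, as pairs (source region, target region). -/
def halfArrows : List (Side × Side) :=
  [(.left, .right), (.left, .right), (.right, .above), (.above, .left),
    (.right, .below), (.below, .left)]

/-- The number of half arrows from the vertex `x` to the vertex `y`, before cancellation. -/
def halfArrowCount (u : Equiv.Perm (Fin (r + 1))) (β : List (Fin r)) (x y : Fin β.length) : ℕ :=
  ∑ j ∈ bridges u β,
    halfArrows.countP fun e => CoversSide u β x j e.1 ∧ CoversSide u β y j e.2

/-- The signed number of arrows from `x` to `y` in the quiver, a half arrow having weight `1/2`. -/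
def arrowWeight (u : Equiv.Perm (Fin (r + 1))) (β : List (Fin r)) (x y : Fin β.length) : ℚ :=
  ((halfArrowCount u β x y : ℚ) - (halfArrowCount u β y x : ℚ)) / 2

/-- The extended exchange matrix, of size `m × (m + f)`. -/
def extendedExchangeMatrix (u : Equiv.Perm (Fin (r + 1))) (β : List (Fin r)) :
    Matrix (Fin (numMutable u β)) (Fin (numMutable u β + numFrozen u β)) ℚ :=
  Matrix.of fun i j =>
    arrowWeight u β (vertex u β (Fin.castAdd (numFrozen u β) i)) (vertex u β j)

/-- The half arrow matrix, of size `(m + f) × (m + f)`. -/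
def halfArrowMatrix (u : Equiv.Perm (Fin (r + 1))) (β : List (Fin r)) :
    Matrix (Fin (numMutable u β + numFrozen u β)) (Fin (numMutable u β + numFrozen u β)) ℚ :=
  Matrix.of fun i j => arrowWeight u β (vertex u β i) (vertex u β j)

/-- The boundary map: the indicator vector of the boundary regions covered by a soap film. -/
def boundaryMap (u : Equiv.Perm (Fin (r + 1))) (β : List (Fin r)) (d : Fin β.length) :
    Fin r → ℤ :=
  fun l => if FilmCovers u β d 0 (l : ℕ) then 1 else 0

/-- `-1/2` times the Cartan matrix of type `A_r`. -/
def formMatrix (r : ℕ) : Matrix (Fin r) (Fin r) ℚ :=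
  Matrix.of fun i j =>
    if i = j then -1 else if (i : ℕ) + 1 = j ∨ (j : ℕ) + 1 = i then 1 / 2 else 0

/-- The boundary correction form. -/
def boundaryForm (a b : Fin r → ℤ) : ℚ :=
  (fun i => (a i : ℚ)) ⬝ᵥ (formMatrix r *ᵥ fun j => (b j : ℚ))

/-- The boundary correction matrix. -/
def boundaryCorrectionMatrix (u : Equiv.Perm (Fin (r + 1))) (β : List (Fin r)) :
    Matrix (Fin (numMutable u β + numFrozen u β)) (Fin (numMutable u β + numFrozen u β)) ℚ :=
  Matrix.of fun i j =>
    boundaryForm (boundaryMap u β (vertex u β i)) (boundaryMap u β (vertex u β j))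

/-- The square extension `B̂` of the extended exchange matrix. -/
def bHat (u : Equiv.Perm (Fin (r + 1))) (β : List (Fin r)) :
    Matrix (Fin (numMutable u β + numFrozen u β)) (Fin (numMutable u β + numFrozen u β)) ℚ :=
  halfArrowMatrix u β + boundaryCorrectionMatrix u β

/-- The matrix `A`, the inverse of `B̂`. -/
def aMatrix (u : Equiv.Perm (Fin (r + 1))) (β : List (Fin r)) :
    Matrix (Fin (numMutable u β + numFrozen u β)) (Fin (numMutable u β + numFrozen u β)) ℚ :=
  (bHat u β)⁻¹

/-- The group of integer vectors killed by a rational matrix. -/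
def integerKernel {m n : ℕ} (B : Matrix (Fin m) (Fin n) ℚ) : Submodule ℤ (Fin n → ℤ) where
  carrier := {v | (B *ᵥ fun j => (v j : ℚ)) = 0}
  zero_mem' := by
    ext i
    simp [Matrix.mulVec, dotProduct]
  add_mem' := by
    intro v w hv hw
    have h : (fun j => (((v + w) j : ℤ) : ℚ)) = (fun j => (v j : ℚ)) + fun j => (w j : ℚ) := by
      ext j
      simp
    simp only [Set.mem_ofPred_eq] at hv hw ⊢
    rw [h, Matrix.mulVec_add, hv, hw, add_zero]
  smul_mem' := by
    intro c v hv
    have h : (fun j => (((c • v) j : ℤ) : ℚ)) = (c : ℚ) • fun j => (v j : ℚ) := by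
      ext j
      simp
    simp only [Set.mem_ofPred_eq] at hv ⊢
    rw [h, Matrix.mulVec_smul, hv, smul_zero]

end BraidVariety

end

/-!
Record a soap film, in each vertical slice, by the indicator function of the levels it covers, viewed
as an element of the root lattice of type `A_r`.  Reading the word from right to left, this vector
changes in a very controlled way at a letter `i`: only its coordinate `i` can change, and at a
crossing it is reflected in the simple root `α_i` (`filmLevel_succ_of_ne`, `filmLevel_crossing`).
For the reflection to be visible on indicator functions, no arc may be turned upside down and no two
arcs may overlap.  Both follow from the invariant `Arc.Valid`, `IsSection`: the strands that matter
are never inverted, and a crossing read from right to left only removes an inversion.  That crossings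
are exactly the inverted pairs of adjacent strands is the exchange property
`exists_word_of_descent`.

For a bridge `j` let `δ_x` be the multiple of `α_i` by which the film of `x` drops at `j`
(`filmJump`), and let `p_x` be the pairing of `α_i` with the film on the right of `j`
(`filmPairing`).  The half arrows at `j` contribute `(p_x δ_y - δ_x p_y) / 2` to the half arrow
matrix.  The boundary correction is `-1/2` times the Cartan form of the films at the left border;
reflections preserve this form, so that telescoping it over the letters leaves only the bridges, with
contributions `(δ_x p_y + p_x δ_y - 2 δ_x δ_y) / 2`.  Adding up,

  `bHat x y = ∑ j, (p_x(j) - δ_x(j)) * δ_y(j)`,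

the sum being over the bridges (`arrowWeight_add_boundaryForm`).  A film lives to the left of its
bridge and starts there as `α_i`; hence both factors are triangular integer matrices, with diagonal
entries `1` and `-1` respectively, and `bHat` is invertible over the integers.

A mutable film does not reach the left border, so the extended exchange matrix consists of the first
rows of `bHat`, and its integer kernel is the image under the inverse of `bHat` of the vectors
supported on the frozen coordinates (`exists_basis_integerKernel`).
-/

noncomputable section

namespace BraidVariety

open scoped Matrix Classical

variable {r : ℕ}

/-! ### Descents and the length of a permutation -/

theorem simpleTransposition_mul_self (i : Fin r) :
    simpleTransposition i * simpleTransposition i = 1 :=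
  Equiv.swap_mul_self _ _

@[simp] theorem simpleTransposition_castSucc (i : Fin r) :
    simpleTransposition i i.castSucc = i.succ :=
  Equiv.swap_apply_left _ _

@[simp] theorem simpleTransposition_succ (i : Fin r) :
    simpleTransposition i i.succ = i.castSucc :=
  Equiv.swap_apply_right _ _

theorem val_simpleTransposition (i : Fin r) (p : Fin (r + 1)) :
    (simpleTransposition i p : ℕ) =
      if (p : ℕ) = i then (i : ℕ) + 1 else if (p : ℕ) = i + 1 then (i : ℕ) else p := by
  unfold simpleTransposition
  rw [Equiv.swap_apply_def]
  simp only [Fin.ext_iff, Fin.val_castSucc, Fin.val_succ]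
  split_ifs <;> simp

theorem exists_wordPerm_eq (v : Equiv.Perm (Fin (r + 1))) : ∃ L : List (Fin r), wordPerm L = v := by
  have hv : v ∈ Submonoid.closure (Set.range fun i : Fin r => Equiv.swap i.castSucc i.succ) := by
    rw [Equiv.Perm.mclosure_swap_castSucc_succ]
    trivial
  induction hv using Submonoid.closure_induction with
  | mem x hx =>
    obtain ⟨i, rfl⟩ := hx
    exact ⟨[i], by simp [wordPerm, simpleTransposition]⟩
  | one => exact ⟨[], rfl⟩
  | mul x y _ _ hx hy =>
    obtain ⟨L, rfl⟩ := hx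
    obtain ⟨M, rfl⟩ := hy
    exact ⟨L ++ M, by simp [wordPerm]⟩

/-- The exchange property of the symmetric group: if `i` is a right descent of the permutation of a
word, then deleting a suitable letter of the word multiplies the permutation by `i`. -/
theorem exists_word_of_descent (i : Fin r) (L : List (Fin r))
    (h : wordPerm L i.succ < wordPerm L i.castSucc) :
    ∃ M : List (Fin r), wordPerm M = wordPerm L * simpleTransposition i ∧
      M.length + 1 = L.length := by
  induction L with
  | nil =>
    simp [wordPerm, Fin.lt_def] at h
  | cons a T ih =>
    have hcons : wordPerm (a :: T) = simpleTransposition a * wordPerm T := by simp [wordPerm]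
    rw [hcons] at h ⊢
    by_cases hT : wordPerm T i.succ < wordPerm T i.castSucc
    · obtain ⟨M, hM, hlen⟩ := ih hT
      exact ⟨a :: M, by rw [mul_assoc, ← hM]; simp [wordPerm], by simp [hlen]⟩
    · -- The letter `a` reverses the values of `wordPerm T` at `i` and `i + 1`, so that these
      -- values are `a` and `a + 1`, and conjugating by `wordPerm T` turns `a` into `i`.
      have hne : wordPerm T i.castSucc ≠ wordPerm T i.succ := by
        simp [Fin.ext_iff]
      have hvals : wordPerm T i.castSucc = a.castSucc ∧ wordPerm T i.succ = a.succ := by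
        simp only [Equiv.Perm.mul_apply, Fin.lt_def, val_simpleTransposition] at h
        simp only [Fin.lt_def, Fin.ext_iff, Fin.val_castSucc, Fin.val_succ, ne_eq] at hT hne ⊢
        split_ifs at h <;> omega
      refine ⟨T, ?_, rfl⟩
      have hconj : simpleTransposition a * wordPerm T = wordPerm T * simpleTransposition i := by
        have := Equiv.mul_swap_eq_swap_mul (wordPerm T) i.castSucc i.succ
        rw [hvals.1, hvals.2] at this
        exact this.symm
      rw [hconj, mul_assoc, simpleTransposition_mul_self, mul_one]

theorem permLength_mul_lt_of_descent (v : Equiv.Perm (Fin (r + 1))) (i : Fin r)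
    (h : v i.succ < v i.castSucc) : permLength (v * simpleTransposition i) < permLength v := by
  obtain ⟨L, hL, hlen⟩ : permLength v ∈ {k | ∃ L : List (Fin r), wordPerm L = v ∧ L.length = k} := by
    obtain ⟨L, hL⟩ := exists_wordPerm_eq v
    exact Nat.sInf_mem ⟨L.length, L, hL, rfl⟩
  obtain ⟨M, hM, hMlen⟩ := exists_word_of_descent i L (by rwa [hL])
  have : permLength (v * simpleTransposition i) ≤ M.length :=
    Nat.sInf_le ⟨M, by rw [hM, hL], rfl⟩
  omega

theorem permLength_mul_lt_iff (v : Equiv.Perm (Fin (r + 1))) (i : Fin r) :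
    permLength (v * simpleTransposition i) < permLength v ↔ v i.succ < v i.castSucc := by
  refine ⟨fun h => ?_, permLength_mul_lt_of_descent v i⟩
  by_contra hlt
  have hne : v i.castSucc ≠ v i.succ := by simp [Fin.ext_iff]
  have := permLength_mul_lt_of_descent (v * simpleTransposition i) i
    (by simpa using lt_of_le_of_ne (not_lt.mp hlt) hne)
  rw [mul_assoc, simpleTransposition_mul_self, mul_one] at this
  omega

/-- At a bridge the two strands are in increasing order. -/
theorem demazureQuotient_eq_self_iff (v : Equiv.Perm (Fin (r + 1))) (i : Fin r) :
    demazureQuotient v i = v ↔ v i.castSucc < v i.succ := by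
  have hne : v i.castSucc ≠ v i.succ := by simp [Fin.ext_iff]
  unfold demazureQuotient
  simp only [permLength_mul_lt_iff]
  split_ifs with h
  · refine ⟨fun heq => ?_, fun h' => absurd h' h.asymm⟩
    have := congrArg (fun w => w i.castSucc) heq
    simp only [Equiv.Perm.mul_apply, simpleTransposition_castSucc] at this
    exact absurd this.symm hne
  · exact ⟨fun _ => lt_of_le_of_ne (not_lt.mp h) hne, fun _ => rfl⟩

theorem demazureQuotient_of_descent {v : Equiv.Perm (Fin (r + 1))} {i : Fin r}
    (h : v i.succ < v i.castSucc) : demazureQuotient v i = v * simpleTransposition i :=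
  if_pos (permLength_mul_lt_of_descent v i h)

/-! ### Arcs and sections of soap films -/

theorem eq_iff_val_symm_eq (v : Equiv.Perm (Fin (r + 1))) (s t : Fin (r + 1)) :
    s = t ↔ (v.symm s : ℕ) = v.symm t := by
  rw [← Fin.ext_iff, v.symm.injective.eq_iff]

/-- The position of a strand on the left of a crossing. -/
theorem val_symm_mul_simpleTransposition (v : Equiv.Perm (Fin (r + 1))) (i : Fin r)
    (s : Fin (r + 1)) : ((v * simpleTransposition i).symm s : ℕ) =
      if (v.symm s : ℕ) = i then (i : ℕ) + 1
      else if (v.symm s : ℕ) = i + 1 then (i : ℕ) else v.symm s := by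
  rw [← val_simpleTransposition]
  rfl

/-- The invariant of an arc along a soap film.  Its ends are in the right order of positions.
Moreover, let `s` be its lower end or a strand in front of it (the arc passes under `s`), and let `t`
be its upper end or a strand behind it (the arc passes over `t`); if `s` is in a lower position than
`t`, then `s < t`, so that these two strands are not inverted.  This is what makes both pieces of an
arc cut by a bridge valid again. -/
def Arc.Valid (v : Equiv.Perm (Fin (r + 1))) (a : Arc r) : Prop :=
  (v.symm a.lower : ℕ) < v.symm a.upper ∧
    ∀ s t : Fin (r + 1), (v.symm a.lower : ℕ) ≤ v.symm s → (v.symm s : ℕ) < v.symm t →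
      (v.symm t : ℕ) ≤ v.symm a.upper → (s = a.lower ∨ s ∉ a.overStrands) →
      (t = a.upper ∨ t ∈ a.overStrands) → s < t

theorem Arc.Valid.lower_lt_upper {v : Equiv.Perm (Fin (r + 1))} {a : Arc r} (h : a.Valid v) :
    a.lower < a.upper :=
  h.2 _ _ le_rfl h.1 le_rfl (Or.inl rfl) (Or.inl rfl)

theorem Arc.passCrossing_lower (v : Equiv.Perm (Fin (r + 1))) (i : Fin r) (a : Arc r) :
    (a.passCrossing v i).lower = a.lower := by
  unfold Arc.passCrossing
  dsimp only
  split_ifs <;> rfl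

theorem Arc.passCrossing_upper (v : Equiv.Perm (Fin (r + 1))) (i : Fin r) (a : Arc r) :
    (a.passCrossing v i).upper = a.upper := by
  unfold Arc.passCrossing
  dsimp only
  split_ifs <;> rfl

/-- A crossing, read from right to left, removes an inversion; so it keeps the relative position of
two strands which are not inverted. -/
theorem symm_lt_symm_of_descent {v : Equiv.Perm (Fin (r + 1))} {i : Fin r}
    (hi : v i.succ < v i.castSucc) {s t : Fin (r + 1)} (hst : s < t)
    (h : (v.symm s : ℕ) < v.symm t) :
    ((v * simpleTransposition i).symm s : ℕ) < (v * simpleTransposition i).symm t := by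
  have hnot : ¬ ((v.symm s : ℕ) = i ∧ (v.symm t : ℕ) = i + 1) := by
    rintro ⟨h1, h2⟩
    have e1 : s = v i.castSucc := by rw [eq_iff_val_symm_eq v]; simpa using h1
    have e2 : t = v i.succ := by rw [eq_iff_val_symm_eq v]; simpa using h2
    rw [e1, e2] at hst
    exact hst.asymm hi
  rw [val_symm_mul_simpleTransposition, val_symm_mul_simpleTransposition]
  split_ifs <;> omega

theorem Arc.Valid.passCrossing {v : Equiv.Perm (Fin (r + 1))} {i : Fin r}
    (hi : v i.succ < v i.castSucc) {a : Arc r} (h : a.Valid v) :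
    (a.passCrossing v i).Valid (v * simpleTransposition i) := by
  refine ⟨?_, ?_⟩
  · rw [passCrossing_lower, passCrossing_upper]
    exact symm_lt_symm_of_descent hi h.lower_lt_upper h.1
  · intro s t h1 h2 h3 hs ht
    rw [passCrossing_lower] at h1 hs
    rw [passCrossing_upper] at h3 ht
    have hlu := symm_lt_symm_of_descent hi h.lower_lt_upper h.1
    have hlu' := h.1
    have hx : (v.symm (v i.castSucc) : ℕ) = i := by simp
    have hy : (v.symm (v i.succ) : ℕ) = i + 1 := by simp
    by_cases hyx : s = v i.succ ∧ t = v i.castSucc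
    · rw [hyx.1, hyx.2]
      exact hi
    · -- Every other pair of strands keeps its order, and the over and under strands other than the
      -- one entering through an end of the arc are the same as before.
      have hyx' : ¬ ((v.symm s : ℕ) = i + 1 ∧ (v.symm t : ℕ) = i) := fun hc => hyx
        ⟨by rw [eq_iff_val_symm_eq v, hy, hc.1], by rw [eq_iff_val_symm_eq v, hx, hc.2]⟩
      have hsx := eq_iff_val_symm_eq v s (v i.castSucc)
      have hsy := eq_iff_val_symm_eq v s (v i.succ)
      have htx := eq_iff_val_symm_eq v t (v i.castSucc)
      have hty := eq_iff_val_symm_eq v t (v i.succ)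
      have hlx := eq_iff_val_symm_eq v a.lower (v i.castSucc)
      have hly := eq_iff_val_symm_eq v a.lower (v i.succ)
      have hux := eq_iff_val_symm_eq v a.upper (v i.castSucc)
      have huy := eq_iff_val_symm_eq v a.upper (v i.succ)
      have hsl := eq_iff_val_symm_eq v s a.lower
      have htu := eq_iff_val_symm_eq v t a.upper
      rw [hx] at hsx htx hlx hux
      rw [hy] at hsy hty hly huy
      simp only [val_symm_mul_simpleTransposition] at h1 h2 h3 hlu
      simp only [Arc.passCrossing] at hs ht
      have hind := h.2 s t
      clear h hyx hi hx hy
      generalize (v.symm s : ℕ) = ps at *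
      generalize (v.symm t : ℕ) = pt at *
      generalize (v.symm a.lower : ℕ) = pl at *
      generalize (v.symm a.upper : ℕ) = pu at *
      generalize v i.castSucc = x at *
      generalize v i.succ = y at *
      have hst : ps < pt := by clear hs ht hind; grind
      split_ifs at hs ht with hu hl
      · simp only [Finset.mem_erase] at hs ht
        apply hind <;> clear hind <;> grind
      · simp only [Finset.mem_insert] at hs ht
        apply hind <;> clear hind <;> grind
      · apply hind <;> clear hind <;> grind

/-- Two arcs of a section of a soap film, the first one below the second one: both the positions and
the names of the strands increase from the upper end of the first to the lower end of the second. -/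
def Arc.Below (v : Equiv.Perm (Fin (r + 1))) (a b : Arc r) : Prop :=
  a.upper < b.lower ∧ (v.symm a.upper : ℕ) < v.symm b.lower

/-- The arcs of a vertical section of a soap film are valid and are listed from bottom to top. -/
def IsSection (v : Equiv.Perm (Fin (r + 1))) (L : List (Arc r)) : Prop :=
  (∀ a ∈ L, a.Valid v) ∧ L.Pairwise (Arc.Below v)

theorem IsSection.map_passCrossing {v : Equiv.Perm (Fin (r + 1))} {i : Fin r}
    (hi : v i.succ < v i.castSucc) {L : List (Arc r)} (h : IsSection v L) :
    IsSection (v * simpleTransposition i) (L.map (Arc.passCrossing v i)) := by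
  refine ⟨?_, ?_⟩
  · simp only [List.mem_map, forall_exists_index, and_imp, forall_apply_eq_imp_iff₂]
    exact fun a ha => (h.1 a ha).passCrossing hi
  · rw [List.pairwise_map]
    refine h.2.imp fun {a b} hab => ?_
    rw [Arc.Below, Arc.passCrossing_lower, Arc.passCrossing_upper]
    exact ⟨hab.1, symm_lt_symm_of_descent hi hab.1 hab.2⟩

/-- The bridge between positions `i` and `i + 1` cuts the arc. -/
def Arc.IsCut (v : Equiv.Perm (Fin (r + 1))) (i : Fin r) (a : Arc r) : Prop :=
  (v.symm a.lower : ℕ) ≤ i ∧ (i : ℕ) < v.symm a.upper ∧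
    (a.upper = v i.succ ∨ v i.succ ∉ a.overStrands) ∧
    (a.lower = v i.castSucc ∨ v i.castSucc ∈ a.overStrands)

theorem Arc.passBridge_of_not_isCut {v : Equiv.Perm (Fin (r + 1))} {i : Fin r} {a : Arc r}
    (h : ¬ a.IsCut v i) : a.passBridge v i = [a] := by
  have hcov : a.Covers v (i : ℕ) ↔ (v.symm a.lower : ℕ) ≤ i ∧ (i : ℕ) < v.symm a.upper := by
    simp [Arc.Covers]
  unfold Arc.IsCut at h
  unfold Arc.passBridge
  dsimp only
  by_cases h1 : a.Covers v (i : ℕ)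
  · rw [if_neg (not_not.mpr h1), if_pos]
    rw [hcov] at h1
    tauto
  · rw [if_pos h1]

theorem Arc.passBridge_of_isCut {v : Equiv.Perm (Fin (r + 1))} {i : Fin r} {a : Arc r}
    (h : a.IsCut v i) : a.passBridge v i =
      (if a.lower ≠ v i.castSucc then [{ a with upper := v i.castSucc }] else []) ++
        (if a.upper ≠ v i.succ then [{ a with lower := v i.succ }] else []) := by
  obtain ⟨h1, h2, h3, h4⟩ := h
  have hcov : a.Covers v (i : ℕ) := ⟨by exact_mod_cast h1, by exact_mod_cast h2⟩
  have hcut : ¬ ((a.upper ≠ v i.succ ∧ v i.succ ∈ a.overStrands) ∨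
      (a.lower ≠ v i.castSucc ∧ v i.castSucc ∉ a.overStrands)) := by tauto
  unfold Arc.passBridge
  simp only [hcov, hcut, not_true_eq_false, if_false]

theorem Arc.mem_passBridge {v : Equiv.Perm (Fin (r + 1))} {i : Fin r} {a c : Arc r}
    (h : a.IsCut v i) : c ∈ a.passBridge v i ↔
      (a.lower ≠ v i.castSucc ∧ c = { a with upper := v i.castSucc }) ∨
        (a.upper ≠ v i.succ ∧ c = { a with lower := v i.succ }) := by
  rw [passBridge_of_isCut h, List.mem_append]
  split_ifs <;> simp_all

/-- The pieces left by a bridge are valid, and lie between the ends of the original arc. -/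
theorem Arc.Valid.of_mem_passBridge {v : Equiv.Perm (Fin (r + 1))} {i : Fin r}
    (hi : v i.castSucc < v i.succ) {a c : Arc r} (h : a.Valid v) (hc : c ∈ a.passBridge v i) :
    c.Valid v ∧ a.lower ≤ c.lower ∧ (v.symm a.lower : ℕ) ≤ v.symm c.lower ∧
      c.upper ≤ a.upper ∧ (v.symm c.upper : ℕ) ≤ v.symm a.upper := by
  have hb : (v.symm (v i.castSucc) : ℕ) = i := by simp
  have ht : (v.symm (v i.succ) : ℕ) = i + 1 := by simp
  by_cases hcut : a.IsCut v i
  · have hind := h.2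
    have hlu := h.lower_lt_upper
    obtain ⟨h1, h2, h3, h4⟩ := id hcut
    rw [mem_passBridge hcut] at hc
    have hlow : a.lower ≠ v i.castSucc → (v.symm a.lower : ℕ) < i := fun hne =>
      lt_of_le_of_ne h1 fun he => hne (by rw [eq_iff_val_symm_eq v, he, hb])
    have hup : a.upper ≠ v i.succ → (i : ℕ) + 1 < v.symm a.upper := fun hne =>
      lt_of_le_of_ne h2 fun he => hne (by rw [eq_iff_val_symm_eq v, ← he, ht])
    -- The ends of the arc and the strands of the bridge come in this order.
    have hlb : a.lower ≤ v i.castSucc := by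
      rcases eq_or_ne a.lower (v i.castSucc) with he | he
      · exact he.le
      · exact (hind a.lower (v i.castSucc) le_rfl (by rw [hb]; exact hlow he)
          (by rw [hb]; omega) (Or.inl rfl) (Or.inr (h4.resolve_left he))).le
    have htu : v i.succ ≤ a.upper := by
      rcases eq_or_ne a.upper (v i.succ) with he | he
      · exact he.ge
      · exact (hind (v i.succ) a.upper (by rw [ht]; omega) (by rw [ht]; exact hup he)
          le_rfl (Or.inr (h3.resolve_left he)) (Or.inl rfl)).le
    rcases hc with ⟨hne, rfl⟩ | ⟨hne, rfl⟩
    · have hmem := h4.resolve_left hne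
      refine ⟨⟨by simpa using hlow hne, fun s t hs hst ht' hs' ht'' => ?_⟩, le_rfl, le_rfl,
        hi.le.trans htu, by simpa using h2.le⟩
      refine hind s t hs hst (ht'.trans (by simpa using h2.le)) hs' ?_
      rcases ht'' with rfl | ht''
      · exact Or.inr hmem
      · exact Or.inr ht''
    · have hmem := h3.resolve_left hne
      refine ⟨⟨by simpa using hup hne, fun s t hs hst ht' hs' ht'' => ?_⟩, hlb.trans hi.le,
        by simpa using h1.trans (Nat.le_succ _), le_rfl, le_rfl⟩
      refine hind s t (le_trans (by simpa using h1.trans (Nat.le_succ _)) hs) hst ht' ?_ ht''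
      rcases hs' with rfl | hs'
      · exact Or.inr hmem
      · exact Or.inr hs'
  · obtain rfl : c = a := by simpa [passBridge_of_not_isCut hcut] using hc
    exact ⟨h, le_rfl, le_rfl, le_rfl, le_rfl⟩

theorem Arc.pairwise_passBridge {v : Equiv.Perm (Fin (r + 1))} {i : Fin r}
    (hi : v i.castSucc < v i.succ) (a : Arc r) : (a.passBridge v i).Pairwise (Arc.Below v) := by
  by_cases hcut : a.IsCut v i
  · rw [passBridge_of_isCut hcut]
    split_ifs <;> simp [Arc.Below, hi]
  · simp [passBridge_of_not_isCut hcut]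

theorem IsSection.flatMap_passBridge {v : Equiv.Perm (Fin (r + 1))} {i : Fin r}
    (hi : v i.castSucc < v i.succ) {L : List (Arc r)} (h : IsSection v L) :
    IsSection v (L.flatMap (Arc.passBridge v i)) := by
  refine ⟨?_, ?_⟩
  · simp only [List.mem_flatMap, forall_exists_index, and_imp]
    exact fun c a ha hc => ((h.1 a ha).of_mem_passBridge hi hc).1
  · rw [List.pairwise_flatMap]
    refine ⟨fun a _ => a.pairwise_passBridge hi, h.2.imp_of_mem fun {a b} ha hb hab c hc d hd => ?_⟩
    obtain ⟨-, -, -, h1, h2⟩ := (h.1 a ha).of_mem_passBridge hi hc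
    obtain ⟨-, h3, h4, -, -⟩ := (h.1 b hb).of_mem_passBridge hi hd
    exact ⟨h1.trans_lt (hab.1.trans_le h3), h2.trans_lt (hab.2.trans_le h4)⟩

/-- A bridge changes the regions covered by a soap film only at its own level. -/
theorem Arc.exists_mem_passBridge_covers (v : Equiv.Perm (Fin (r + 1))) (i : Fin r) (a : Arc r)
    {l : ℤ} (hl : l ≠ (i : ℕ)) : (∃ c ∈ a.passBridge v i, c.Covers v l) ↔ a.Covers v l := by
  by_cases hcut : a.IsCut v i
  · simp only [mem_passBridge hcut, or_and_right, exists_or, and_assoc, exists_and_left,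
      exists_eq_left, Arc.Covers, eq_iff_val_symm_eq v, Ne]
    obtain ⟨h1, h2, -, -⟩ := hcut
    simp only [Equiv.symm_apply_apply, Fin.val_castSucc, Fin.val_succ]
    omega
  · simp [passBridge_of_not_isCut hcut]

/-- The indicator function of the levels above a strand. -/
def stepAt (v : Equiv.Perm (Fin (r + 1))) (s : Fin (r + 1)) (l : ℤ) : ℤ :=
  if ((v.symm s : ℕ) : ℤ) ≤ l then 1 else 0

/-- The number of arcs covering a level, as a linear expression in the steps at their ends. -/
def sectionSum (v : Equiv.Perm (Fin (r + 1))) (L : List (Arc r)) (l : ℤ) : ℤ :=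
  (L.map fun a => stepAt v a.lower l - stepAt v a.upper l).sum

/-- A level is covered at most once by a section of a soap film. -/
theorem IsSection.sectionSum_eq {v : Equiv.Perm (Fin (r + 1))} {L : List (Arc r)}
    (h : IsSection v L) (l : ℤ) :
    sectionSum v L l = if ∃ a ∈ L, a.Covers v l then 1 else 0 := by
  obtain ⟨hval, hpair⟩ := h
  induction L with
  | nil => simp [sectionSum]
  | cons a T ih =>
    rw [List.pairwise_cons] at hpair
    have hT := ih (fun b hb => hval b (List.mem_cons_of_mem _ hb)) hpair.2
    have hsum : sectionSum v (a :: T) l =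
        stepAt v a.lower l - stepAt v a.upper l + sectionSum v T l := by simp [sectionSum]
    have ha := (hval a List.mem_cons_self).1
    have hterm : stepAt v a.lower l - stepAt v a.upper l = if a.Covers v l then 1 else 0 := by
      unfold stepAt Arc.Covers
      split_ifs <;> omega
    have hdisj : a.Covers v l → ¬ ∃ b ∈ T, b.Covers v l := by
      rintro ⟨h1, h2⟩ ⟨b, hb, h3, h4⟩
      have := (hpair.1 b hb).2
      omega
    rw [hsum, hterm, hT]
    simp only [List.exists_mem_cons_iff]
    by_cases hc : a.Covers v l
    · simp [hc, hdisj hc]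
    · simp [hc]

/-- A crossing acts on the regions covered by a soap film as a simple reflection. -/
theorem sectionSum_map_passCrossing (v : Equiv.Perm (Fin (r + 1))) (i : Fin r) (L : List (Arc r))
    (l : ℤ) : sectionSum (v * simpleTransposition i) (L.map (Arc.passCrossing v i)) l =
      if l = (i : ℕ) then
        sectionSum v L (l + 1) + sectionSum v L (l - 1) - sectionSum v L l
      else sectionSum v L l := by
  have hstep : ∀ s, stepAt (v * simpleTransposition i) s l =
      if l = (i : ℕ) then stepAt v s (l + 1) + stepAt v s (l - 1) - stepAt v s l
      else stepAt v s l := by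
    intro s
    unfold stepAt
    rw [val_symm_mul_simpleTransposition]
    split_ifs <;> omega
  induction L with
  | nil => simp [sectionSum]
  | cons a T ih =>
    have hsum : ∀ w (b : Arc r) M l', sectionSum w (b :: M) l' =
        stepAt w b.lower l' - stepAt w b.upper l' + sectionSum w M l' := by simp [sectionSum]
    rw [List.map_cons, hsum, ih, Arc.passCrossing_lower, Arc.passCrossing_upper, hstep, hstep]
    simp only [hsum]
    split_ifs <;> ring

/-! ### The regions covered by a soap film -/

theorem isSection_leftFilm (u : Equiv.Perm (Fin (r + 1))) (β : List (Fin r)) (d : ℕ) :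
    IsSection (leftPerm u β) (leftFilm u β d) := by
  have hnil : ∀ v : Equiv.Perm (Fin (r + 1)), IsSection v [] := fun v => by simp [IsSection]
  induction β generalizing d with
  | nil => simpa [leftFilm] using hnil _
  | cons i β ih =>
    have hleft : leftPerm u (i :: β) = demazureQuotient (leftPerm u β) i := rfl
    rw [hleft]
    by_cases h : demazureQuotient (leftPerm u β) i = leftPerm u β
    · have hi := (demazureQuotient_eq_self_iff _ _).mp h
      cases d with
      | zero =>
        simp only [leftFilm, h, if_true]
        refine ⟨?_, by simp⟩
        simp only [List.mem_singleton, forall_eq]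
        refine ⟨by simp, fun s t hs hst ht _ _ => ?_⟩
        simp only [Equiv.symm_apply_apply, Fin.val_castSucc, Fin.val_succ] at hs ht
        have e1 : s = (leftPerm u β) i.castSucc := by
          rw [eq_iff_val_symm_eq (leftPerm u β)]; simp; omega
        have e2 : t = (leftPerm u β) i.succ := by
          rw [eq_iff_val_symm_eq (leftPerm u β)]; simp; omega
        rw [e1, e2]
        exact hi
      | succ d =>
        simp only [leftFilm, h, if_true]
        exact (ih d).flatMap_passBridge hi
    · cases d with
      | zero => simpa [leftFilm, h] using hnil _
      | succ d =>
        simp only [leftFilm, h, if_false]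
        have hi : leftPerm u β i.succ < leftPerm u β i.castSucc := by
          rw [demazureQuotient_eq_self_iff, not_lt] at h
          exact lt_of_le_of_ne h (by simp [Fin.ext_iff])
        rw [demazureQuotient_of_descent hi]
        exact (ih d).map_passCrossing hi

/-- The indicator function of the regions of slice `j` covered by the soap film of `d`. -/
def filmLevel (u : Equiv.Perm (Fin (r + 1))) (β : List (Fin r)) (d j : ℕ) (l : ℤ) : ℤ :=
  if FilmCovers u β d j l then 1 else 0

theorem filmLevel_of_lt (u : Equiv.Perm (Fin (r + 1))) (β : List (Fin r)) {d j : ℕ} (h : d < j)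
    (l : ℤ) : filmLevel u β d j l = 0 :=
  if_neg fun hc => absurd hc.1 (not_le.mpr h)

/-- A soap film covers no region below the bottom strand or above the top strand. -/
theorem filmLevel_of_out_of_range (u : Equiv.Perm (Fin (r + 1))) (β : List (Fin r)) (d j : ℕ)
    {l : ℤ} (hl : l < 0 ∨ (r : ℤ) ≤ l) : filmLevel u β d j l = 0 := by
  refine if_neg ?_
  rintro ⟨-, a, -, h1, h2⟩
  have := ((slicePerm u β j).symm a.upper).isLt
  omega

theorem filmLevel_eq_sectionSum (u : Equiv.Perm (Fin (r + 1))) (β : List (Fin r)) {d j : ℕ}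
    (h : j ≤ d) (l : ℤ) : filmLevel u β d j l =
      sectionSum (slicePerm u β j) (leftFilm u (β.drop j) (d - j)) l := by
  rw [slicePerm, (isSection_leftFilm u (β.drop j) (d - j)).sectionSum_eq, filmLevel, FilmCovers]
  simp only [h, true_and]
  rfl

theorem mem_bridges_iff (u : Equiv.Perm (Fin (r + 1))) (β : List (Fin r)) (j : Fin β.length) :
    j ∈ bridges u β ↔
      demazureQuotient (leftPerm u (β.drop (j + 1))) (β.get j) = leftPerm u (β.drop (j + 1)) := by
  have hdrop : β.drop j = β.get j :: β.drop (j + 1) := List.drop_eq_getElem_cons j.isLt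
  rw [bridges, Finset.mem_filter, slicePerm, slicePerm, hdrop]
  simp only [Finset.mem_univ, true_and]
  exact eq_comm

/-- A soap film starts at its bridge as the region to the left of the bridge. -/
theorem filmLevel_self {u : Equiv.Perm (Fin (r + 1))} {β : List (Fin r)} {d : Fin β.length}
    (hd : d ∈ bridges u β) (l : ℤ) :
    filmLevel u β d d l = if l = (β.get d : ℕ) then 1 else 0 := by
  have hdrop : β.drop d = β.get d :: β.drop (d + 1) := List.drop_eq_getElem_cons d.isLt
  rw [mem_bridges_iff] at hd
  have hperm : slicePerm u β d = leftPerm u (β.drop (d + 1)) := by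
    rw [slicePerm, hdrop]
    exact hd
  have hfilm : leftFilm u (β.drop d) 0 = [⟨leftPerm u (β.drop (d + 1)) (β.get d).castSucc,
      leftPerm u (β.drop (d + 1)) (β.get d).succ, ∅⟩] := by
    rw [hdrop]
    simp only [leftFilm, hd, if_true]
  rw [filmLevel, FilmCovers, hperm, Nat.sub_self, hfilm]
  simp only [le_refl, true_and, List.mem_singleton, exists_eq_left, Arc.Covers,
    Equiv.symm_apply_apply, Fin.val_castSucc, Fin.val_succ]
  split_ifs <;> omega

/-- A crossing reflects the regions covered by a soap film. -/
theorem filmLevel_crossing (u : Equiv.Perm (Fin (r + 1))) (β : List (Fin r)) {d j : Fin β.length}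
    (hd : d ∈ bridges u β) (hj : j ∉ bridges u β) (l : ℤ) :
    filmLevel u β d j l = if l = (β.get j : ℕ) then
        filmLevel u β d (j + 1) (l + 1) + filmLevel u β d (j + 1) (l - 1) -
          filmLevel u β d (j + 1) l
      else filmLevel u β d (j + 1) l := by
  rcases lt_trichotomy d j with h | rfl | h
  · simp only [filmLevel_of_lt u β h, filmLevel_of_lt u β (Nat.lt_succ_of_lt h)]
    simp
  · exact absurd hd hj
  · have h' : (j : ℕ) + 1 ≤ d := h
    have hdrop : β.drop j = β.get j :: β.drop (j + 1) := List.drop_eq_getElem_cons j.isLt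
    have hsub : (d : ℕ) - j = (d - (j + 1)) + 1 := by omega
    rw [mem_bridges_iff] at hj
    have hi : leftPerm u (β.drop (j + 1)) (β.get j).succ <
        leftPerm u (β.drop (j + 1)) (β.get j).castSucc := by
      rw [demazureQuotient_eq_self_iff, not_lt] at hj
      exact lt_of_le_of_ne hj (by simp [Fin.ext_iff])
    have hperm : leftPerm u (β.get j :: β.drop (j + 1)) =
        leftPerm u (β.drop (j + 1)) * simpleTransposition (β.get j) :=
      demazureQuotient_of_descent hi
    rw [filmLevel_eq_sectionSum u β h.le]
    simp only [filmLevel_eq_sectionSum u β h']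
    unfold slicePerm
    rw [hdrop, hsub, hperm]
    simp only [leftFilm, hj, if_false]
    exact sectionSum_map_passCrossing _ _ _ _

/-- A letter changes the regions covered by a soap film only at its own level. -/
theorem filmLevel_succ_of_ne (u : Equiv.Perm (Fin (r + 1))) (β : List (Fin r)) {d j : Fin β.length}
    (hd : d ∈ bridges u β) {l : ℤ} (hl : l ≠ (β.get j : ℕ)) :
    filmLevel u β d j l = filmLevel u β d (j + 1) l := by
  rcases lt_trichotomy d j with h | rfl | h
  · rw [filmLevel_of_lt u β h, filmLevel_of_lt u β (Nat.lt_succ_of_lt h)]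
  · rw [filmLevel_self hd, if_neg hl, filmLevel_of_lt u β (Nat.lt_succ_self _)]
  · have h' : (j : ℕ) + 1 ≤ d := h
    have hdrop : β.drop j = β.get j :: β.drop (j + 1) := List.drop_eq_getElem_cons j.isLt
    have hsub : (d : ℕ) - j = (d - (j + 1)) + 1 := by omega
    by_cases hj : j ∈ bridges u β
    · rw [mem_bridges_iff] at hj
      unfold filmLevel FilmCovers slicePerm
      rw [hdrop, hsub]
      have hperm : leftPerm u (β.get j :: β.drop (j + 1)) = leftPerm u (β.drop (j + 1)) := hj
      rw [hperm]
      simp only [leftFilm, hj, if_true, h', Nat.le_of_succ_le h', true_and, List.mem_flatMap]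
      refine if_congr ⟨?_, ?_⟩ rfl rfl
      · rintro ⟨c, ⟨a, ha, hc⟩, hcov⟩
        exact ⟨a, ha, (a.exists_mem_passBridge_covers _ _ hl).mp ⟨c, hc, hcov⟩⟩
      · rintro ⟨a, ha, hcov⟩
        obtain ⟨c, hc, hcov'⟩ := (a.exists_mem_passBridge_covers _ _ hl).mpr hcov
        exact ⟨c, ⟨a, ha, hc⟩, hcov'⟩
    · rw [filmLevel_crossing u β hd hj, if_neg hl]

/-- The drop, from the right of the letter `j` to its left, of the indicator function of the film of
`d` at the level of this letter. -/
def filmJump (u : Equiv.Perm (Fin (r + 1))) (β : List (Fin r)) (d j : Fin β.length) : ℤ :=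
  filmLevel u β d (j + 1) (β.get j : ℕ) - filmLevel u β d j (β.get j : ℕ)

/-- The pairing, in the root lattice, of the soap film of `d` on the right of the letter `j` with the
simple root of this letter. -/
def filmPairing (u : Equiv.Perm (Fin (r + 1))) (β : List (Fin r)) (d j : Fin β.length) : ℤ :=
  2 * filmLevel u β d (j + 1) (β.get j : ℕ) - filmLevel u β d (j + 1) ((β.get j : ℕ) - 1) -
    filmLevel u β d (j + 1) ((β.get j : ℕ) + 1)

/-- At a crossing the film is reflected: the multiple of the simple root that is subtracted is the
pairing with this root. -/
theorem filmJump_eq_filmPairing {u : Equiv.Perm (Fin (r + 1))} {β : List (Fin r)}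
    {d j : Fin β.length} (hd : d ∈ bridges u β) (hj : j ∉ bridges u β) :
    filmJump u β d j = filmPairing u β d j := by
  rw [filmJump, filmPairing, filmLevel_crossing u β hd hj, if_pos rfl]
  ring

theorem filmLevel_eq_sub {u : Equiv.Perm (Fin (r + 1))} {β : List (Fin r)}
    {d : Fin β.length} (hd : d ∈ bridges u β) (j : Fin β.length) (l : ℤ) :
    filmLevel u β d j l =
      filmLevel u β d (j + 1) l - if l = (β.get j : ℕ) then filmJump u β d j else 0 := by
  split_ifs with hl
  · rw [filmJump, hl]
    ring
  · rw [filmLevel_succ_of_ne u β hd hl, sub_zero]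

theorem filmJump_self {u : Equiv.Perm (Fin (r + 1))} {β : List (Fin r)} {d : Fin β.length}
    (hd : d ∈ bridges u β) : filmJump u β d d = -1 := by
  rw [filmJump, filmLevel_of_lt u β (Nat.lt_succ_self _), filmLevel_self hd, if_pos rfl, zero_sub]

theorem filmJump_of_lt (u : Equiv.Perm (Fin (r + 1))) (β : List (Fin r)) {d j : Fin β.length}
    (h : d < j) : filmJump u β d j = 0 := by
  rw [filmJump, filmLevel_of_lt u β (Nat.lt_succ_of_lt h), filmLevel_of_lt u β h, sub_zero]

theorem filmPairing_of_le (u : Equiv.Perm (Fin (r + 1))) (β : List (Fin r)) {d j : Fin β.length}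
    (h : d ≤ j) : filmPairing u β d j = 0 := by
  have h' : (d : ℕ) < j + 1 := Nat.lt_succ_of_le h
  simp only [filmPairing, filmLevel_of_lt u β h']
  simp

/-! ### The half arrow form and the Cartan form -/

/-- The Cartan form of type `A_r`, on functions of the levels. -/
def cartanForm (r : ℕ) (f g : ℤ → ℤ) : ℤ :=
  ∑ l : Fin r, f (l : ℕ) * (2 * g (l : ℕ) - g ((l : ℕ) - 1) - g ((l : ℕ) + 1))

theorem sum_fin_ite_eq {R : Type*} [AddCommMonoid R] (h : ℤ → R) (z : ℤ)
    (hz : z < 0 ∨ (r : ℤ) ≤ z → h z = 0) :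
    ∑ l : Fin r, (if ((l : ℕ) : ℤ) = z then h (l : ℕ) else 0) = h z := by
  by_cases hin : 0 ≤ z ∧ z < r
  · have hlt : z.toNat < r := by omega
    have hval : ((z.toNat : ℕ) : ℤ) = z := by omega
    rw [Finset.sum_eq_single (⟨z.toNat, hlt⟩ : Fin r)]
    · simp [hval]
    · intro b _ hb
      refine if_neg fun hc => hb ?_
      rw [Fin.ext_iff]
      simp only
      omega
    · simp
  · rw [hz (by omega)]
    exact Finset.sum_eq_zero fun l _ => if_neg (by have := l.isLt; omega)

/-- The boundary form only sees the levels `0, ..., r - 1`; the Cartan form also evaluates `g` at the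
levels `-1` and `r`, where it has to vanish. -/
theorem boundaryForm_eq_cartanForm (f g : ℤ → ℤ) (hg : ∀ l, l < 0 ∨ (r : ℤ) ≤ l → g l = 0) :
    boundaryForm (fun l : Fin r => f (l : ℕ)) (fun l : Fin r => g (l : ℕ)) =
      -(cartanForm r f g : ℚ) / 2 := by
  have hrow : ∀ i : Fin r, (formMatrix r *ᵥ fun j : Fin r => ((g (j : ℕ) : ℤ) : ℚ)) i =
      -(2 * g (i : ℕ) - g ((i : ℕ) - 1) - g ((i : ℕ) + 1) : ℚ) / 2 := by
    intro i
    have hterm : ∀ j : Fin r, formMatrix r i j * ((g (j : ℕ) : ℤ) : ℚ) =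
        (if ((j : ℕ) : ℤ) = (i : ℕ) then -(g (j : ℕ) : ℚ) else 0) +
        (if ((j : ℕ) : ℤ) = (i : ℕ) - 1 then (g (j : ℕ) : ℚ) / 2 else 0) +
        (if ((j : ℕ) : ℤ) = (i : ℕ) + 1 then (g (j : ℕ) : ℚ) / 2 else 0) := by
      intro j
      simp only [formMatrix, Matrix.of_apply, Fin.ext_iff]
      split_ifs <;> first | omega | ring
    simp only [Matrix.mulVec, dotProduct, hterm, Finset.sum_add_distrib]
    rw [sum_fin_ite_eq (fun l => -(g l : ℚ)), sum_fin_ite_eq (fun l => (g l : ℚ) / 2),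
      sum_fin_ite_eq (fun l => (g l : ℚ) / 2)]
    · ring
    all_goals
      intro h
      simp [hg _ h]
  simp only [boundaryForm, dotProduct, hrow, cartanForm]
  push_cast
  rw [neg_div, Finset.sum_div, ← Finset.sum_neg_distrib]
  exact Finset.sum_congr rfl fun i _ => by ring

/-- The effect on the Cartan form of subtracting multiples of the simple root `i` from both
arguments. -/
theorem cartanForm_sub_ite (f g : ℤ → ℤ) (hf : ∀ l, l < 0 ∨ (r : ℤ) ≤ l → f l = 0)
    (i : Fin r) (a b : ℤ) :
    cartanForm r (fun l => f l - if l = (i : ℕ) then a else 0)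
        (fun l => g l - if l = (i : ℕ) then b else 0) =
      cartanForm r f g - a * (2 * g (i : ℕ) - g ((i : ℕ) - 1) - g ((i : ℕ) + 1)) -
        b * (2 * f (i : ℕ) - f ((i : ℕ) - 1) - f ((i : ℕ) + 1)) + 2 * (a * b) := by
  have hterm : ∀ l : Fin r,
      (f (l : ℕ) - if ((l : ℕ) : ℤ) = (i : ℕ) then a else 0) *
        (2 * (g (l : ℕ) - if ((l : ℕ) : ℤ) = (i : ℕ) then b else 0) -
          (g ((l : ℕ) - 1) - if ((l : ℕ) : ℤ) - 1 = (i : ℕ) then b else 0) -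
          (g ((l : ℕ) + 1) - if ((l : ℕ) : ℤ) + 1 = (i : ℕ) then b else 0)) =
      f (l : ℕ) * (2 * g (l : ℕ) - g ((l : ℕ) - 1) - g ((l : ℕ) + 1)) +
      (if ((l : ℕ) : ℤ) = (i : ℕ) then
        -a * (2 * g (l : ℕ) - g ((l : ℕ) - 1) - g ((l : ℕ) + 1)) + 2 * (a * b) else 0) +
      (if ((l : ℕ) : ℤ) = (i : ℕ) then -2 * b * f (l : ℕ) else 0) +
      (if ((l : ℕ) : ℤ) = (i : ℕ) + 1 then b * f (l : ℕ) else 0) +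
      (if ((l : ℕ) : ℤ) = (i : ℕ) - 1 then b * f (l : ℕ) else 0) := by
    intro l
    split_ifs <;> first | omega | ring
  have hi := i.isLt
  simp only [cartanForm, hterm, Finset.sum_add_distrib]
  rw [sum_fin_ite_eq (fun l => -a * (2 * g l - g (l - 1) - g (l + 1)) + 2 * (a * b)),
    sum_fin_ite_eq (fun l => -2 * b * f l), sum_fin_ite_eq (fun l => b * f l),
    sum_fin_ite_eq (fun l => b * f l)]
  · ring
  · intro h
    simp [hf _ h]
  · intro h
    simp [hf _ h]
  · intro h
    omega
  · intro h
    omega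

/-- The Cartan form of two soap films on the left border, collected letter by letter: a crossing
preserves the form, being a reflection, so that only the bridges contribute. -/
theorem cartanForm_filmLevel_zero {u : Equiv.Perm (Fin (r + 1))} {β : List (Fin r)}
    {x y : Fin β.length} (hx : x ∈ bridges u β) (hy : y ∈ bridges u β) :
    cartanForm r (filmLevel u β x 0) (filmLevel u β y 0) =
      ∑ j ∈ bridges u β, (2 * (filmJump u β x j * filmJump u β y j) -
        filmJump u β x j * filmPairing u β y j - filmJump u β y j * filmPairing u β x j) := by
  set F : ℕ → ℤ := fun j => cartanForm r (filmLevel u β x j) (filmLevel u β y j) with hF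
  have hstep : ∀ j : Fin β.length, F j - F (j + 1) = 2 * (filmJump u β x j * filmJump u β y j) -
      filmJump u β x j * filmPairing u β y j - filmJump u β y j * filmPairing u β x j := by
    intro j
    have e := cartanForm_sub_ite (filmLevel u β x (j + 1)) (filmLevel u β y (j + 1))
      (fun l => filmLevel_of_out_of_range u β x (j + 1)) (β.get j)
      (filmJump u β x j) (filmJump u β y j)
    simp only [← filmLevel_eq_sub hx, ← filmLevel_eq_sub hy] at e
    have e' : F j = _ := e
    rw [e', filmPairing, filmPairing, hF]
    ring
  have hend : F β.length = 0 := by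
    simp only [hF, cartanForm]
    exact Finset.sum_eq_zero fun l _ => by rw [filmLevel_of_lt u β x.isLt, zero_mul]
  have htel : ∑ j : Fin β.length, (F j - F (j + 1)) = F 0 := by
    rw [Fin.sum_univ_eq_sum_range (fun j => F j - F (j + 1)), Finset.sum_range_sub', hend, sub_zero]
  change F 0 = _
  rw [← htel, ← Finset.sum_subset (Finset.subset_univ (bridges u β))]
  · exact Finset.sum_congr rfl fun j _ => hstep j
  · intro j _ hj
    rw [hstep, filmJump_eq_filmPairing hx hj, filmJump_eq_filmPairing hy hj]
    ring

theorem halfArrowCount_eq (u : Equiv.Perm (Fin (r + 1))) (β : List (Fin r)) (x y : Fin β.length) :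
    (halfArrowCount u β x y : ℤ) = ∑ j ∈ bridges u β,
      (2 * (filmLevel u β x j (β.get j : ℕ) * filmLevel u β y (j + 1) (β.get j : ℕ)) +
        filmLevel u β x (j + 1) (β.get j : ℕ) * filmLevel u β y (j + 1) ((β.get j : ℕ) + 1) +
        filmLevel u β x (j + 1) ((β.get j : ℕ) + 1) * filmLevel u β y j (β.get j : ℕ) +
        filmLevel u β x (j + 1) (β.get j : ℕ) * filmLevel u β y (j + 1) ((β.get j : ℕ) - 1) +
        filmLevel u β x (j + 1) ((β.get j : ℕ) - 1) * filmLevel u β y j (β.get j : ℕ)) := by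
  rw [halfArrowCount]
  push_cast
  refine Finset.sum_congr rfl fun j _ => ?_
  obtain ⟨c, hc⟩ : ∃ c : Prop → ℤ, ∀ P, c P = if P then 1 else 0 := ⟨_, fun _ => rfl⟩
  have hcount : ∀ L : List (Side × Side),
      ((L.countP fun e => CoversSide u β x j e.1 ∧ CoversSide u β y j e.2 : ℕ) : ℤ) =
      (L.map fun e => c (CoversSide u β x j e.1) * c (CoversSide u β y j e.2)).sum := by
    intro L
    induction L with
    | nil => rfl
    | cons e L ih =>
      rw [List.countP_cons, Nat.cast_add, ih, List.map_cons, List.sum_cons, add_comm]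
      by_cases hP : CoversSide u β x j e.1 <;> by_cases hQ : CoversSide u β y j e.2 <;>
        simp [hc, hP, hQ]
  have hlevel : ∀ d k l, filmLevel u β d k l = c (FilmCovers u β d k l) := fun d k l => (hc _).symm
  rw [hcount]
  simp only [halfArrows, List.map_cons, List.map_nil, List.sum_cons, List.sum_nil, CoversSide,
    hlevel]
  ring

/-- The entry of `bHat` at the bridges `x` and `y`. -/
theorem arrowWeight_add_boundaryForm {u : Equiv.Perm (Fin (r + 1))} {β : List (Fin r)}
    {x y : Fin β.length} (hx : x ∈ bridges u β) (hy : y ∈ bridges u β) :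
    arrowWeight u β x y + boundaryForm (boundaryMap u β x) (boundaryMap u β y) =
      ((∑ j ∈ bridges u β, (filmPairing u β x j - filmJump u β x j) * filmJump u β y j : ℤ) : ℚ) := by
  have hform : boundaryForm (boundaryMap u β x) (boundaryMap u β y) = _ :=
    boundaryForm_eq_cartanForm (filmLevel u β x 0) (filmLevel u β y 0)
      (fun l => filmLevel_of_out_of_range u β y 0)
  have hint : (halfArrowCount u β x y : ℤ) - halfArrowCount u β y x -
      cartanForm r (filmLevel u β x 0) (filmLevel u β y 0) =
      2 * ∑ j ∈ bridges u β, (filmPairing u β x j - filmJump u β x j) * filmJump u β y j := by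
    rw [cartanForm_filmLevel_zero hx hy, halfArrowCount_eq, halfArrowCount_eq, Finset.mul_sum,
      ← Finset.sum_sub_distrib, ← Finset.sum_sub_distrib]
    refine Finset.sum_congr rfl fun j _ => ?_
    simp only [filmPairing, filmJump]
    ring
  have hrat := congrArg (fun z : ℤ => (z : ℚ)) hint
  simp only [Int.cast_sub, Int.cast_mul, Int.cast_ofNat, Int.cast_natCast] at hrat
  rw [hform, arrowWeight]
  linarith

/-! ### The integer form of `bHat` and the integer kernel -/

/-- The matrix of `bHat` indexed by the bridges, as a product of two triangular integer matrices. -/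
def seifertMatrix (u : Equiv.Perm (Fin (r + 1))) (β : List (Fin r)) :
    Matrix (bridges u β) (bridges u β) ℤ :=
  (Matrix.of fun x j : bridges u β => filmPairing u β x j - filmJump u β x j) *
    (Matrix.of fun y j : bridges u β => filmJump u β y j)ᵀ

theorem isUnit_det_seifertMatrix (u : Equiv.Perm (Fin (r + 1))) (β : List (Fin r)) :
    IsUnit (seifertMatrix u β).det := by
  rw [seifertMatrix, Matrix.det_mul, Matrix.det_transpose, Matrix.det_of_isLowerTriangular,
    Matrix.det_of_isLowerTriangular]
  · simpa [filmPairing_of_le, filmJump_self] using (isUnit_one.neg : IsUnit (-1 : ℤ)).pow _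
  · exact fun y j h => filmJump_of_lt u β h
  · intro x j h
    have h' : (x : Fin β.length) < j := h
    simp [filmPairing_of_le u β h'.le, filmJump_of_lt u β h']

theorem vertex_mem_bridges (u : Equiv.Perm (Fin (r + 1))) (β : List (Fin r))
    (k : Fin (numMutable u β + numFrozen u β)) : vertex u β k ∈ bridges u β := by
  refine Fin.addCases (fun i => ?_) (fun i => ?_) k
  · rw [vertex, Fin.addCases_left]
    exact (Finset.mem_filter.mp (Finset.orderEmbOfFin_mem (mutableBridges u β) rfl i)).1
  · rw [vertex, Fin.addCases_right]
    exact (Finset.mem_filter.mp (Finset.orderEmbOfFin_mem (frozenBridges u β) rfl i)).1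

theorem not_isFrozen_vertex (u : Equiv.Perm (Fin (r + 1))) (β : List (Fin r))
    (i : Fin (numMutable u β)) :
    ¬ IsFrozen u β (vertex u β (Fin.castAdd (numFrozen u β) i)) := by
  rw [vertex, Fin.addCases_left]
  exact (Finset.mem_filter.mp (Finset.orderEmbOfFin_mem (mutableBridges u β) rfl i)).2

theorem vertex_surjective (u : Equiv.Perm (Fin (r + 1))) (β : List (Fin r)) {d : Fin β.length}
    (hd : d ∈ bridges u β) : ∃ k, vertex u β k = d := by
  by_cases h : IsFrozen u β d
  · have hmem : d ∈ frozenBridges u β := Finset.mem_filter.mpr ⟨hd, h⟩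
    rw [← Finset.mem_coe, ← Finset.range_orderEmbOfFin (frozenBridges u β) rfl] at hmem
    obtain ⟨i, hi⟩ := hmem
    exact ⟨Fin.natAdd _ i, (Fin.addCases_right (m := numMutable u β) i).trans hi⟩
  · have hmem : d ∈ mutableBridges u β := Finset.mem_filter.mpr ⟨hd, h⟩
    rw [← Finset.mem_coe, ← Finset.range_orderEmbOfFin (mutableBridges u β) rfl] at hmem
    obtain ⟨i, hi⟩ := hmem
    exact ⟨Fin.castAdd _ i, (Fin.addCases_left (n := numFrozen u β) i).trans hi⟩

/-- The enumeration of the bridges as a bijection. -/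
def vertexEquiv (u : Equiv.Perm (Fin (r + 1))) (β : List (Fin r)) :
    Fin (numMutable u β + numFrozen u β) ≃ bridges u β :=
  Equiv.ofBijective (fun k => ⟨vertex u β k, vertex_mem_bridges u β k⟩) <| by
    rw [Fintype.bijective_iff_surjective_and_card]
    refine ⟨fun d => ?_, ?_⟩
    · obtain ⟨k, hk⟩ := vertex_surjective u β d.2
      exact ⟨k, Subtype.ext hk⟩
    · rw [Fintype.card_fin, Fintype.card_coe, numMutable, numFrozen, mutableBridges, frozenBridges,
        add_comm, Finset.card_filter_add_card_filter_not]

theorem bHat_eq (u : Equiv.Perm (Fin (r + 1))) (β : List (Fin r)) :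
    bHat u β = ((seifertMatrix u β).submatrix (vertexEquiv u β) (vertexEquiv u β)).map
      (Int.castRingHom ℚ) := by
  ext i j
  have h := arrowWeight_add_boundaryForm (vertex_mem_bridges u β i) (vertex_mem_bridges u β j)
  rw [← Finset.sum_coe_sort] at h
  exact h

theorem extendedExchangeMatrix_eq (u : Equiv.Perm (Fin (r + 1))) (β : List (Fin r))
    (i : Fin (numMutable u β)) (j : Fin (numMutable u β + numFrozen u β)) :
    extendedExchangeMatrix u β i j = bHat u β (Fin.castAdd (numFrozen u β) i) j := by
  have hzero : boundaryMap u β (vertex u β (Fin.castAdd (numFrozen u β) i)) = 0 := by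
    funext l
    exact if_neg fun hc => not_isFrozen_vertex u β i ⟨l, hc⟩
  have hform : boundaryForm (boundaryMap u β (vertex u β (Fin.castAdd (numFrozen u β) i)))
      (boundaryMap u β (vertex u β j)) = 0 := by
    rw [hzero, boundaryForm]
    simp [dotProduct]
  simp only [extendedExchangeMatrix, bHat, halfArrowMatrix, boundaryCorrectionMatrix,
    Matrix.add_apply, Matrix.of_apply, hform, add_zero]

theorem mem_integerKernel_iff {m f : ℕ} {S : Matrix (Fin (m + f)) (Fin (m + f)) ℤ}
    {B : Matrix (Fin m) (Fin (m + f)) ℚ} (hB : ∀ i j, B i j = S (Fin.castAdd f i) j)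
    (v : Fin (m + f) → ℤ) :
    v ∈ integerKernel B ↔ ∀ i : Fin m, (S *ᵥ v) (Fin.castAdd f i) = 0 := by
  change (B *ᵥ fun j => (v j : ℚ)) = 0 ↔ _
  rw [funext_iff]
  refine forall_congr' fun i => ?_
  rw [← Int.cast_inj (α := ℚ)]
  simp [Matrix.mulVec, dotProduct, hB]

/-- If a matrix consists of the first rows of an invertible integer matrix, then the remaining
columns of the inverse form a basis of its integer kernel. -/
theorem exists_basis_integerKernel {m f : ℕ} {S : Matrix (Fin (m + f)) (Fin (m + f)) ℤ}
    (hS : IsUnit S.det) {B : Matrix (Fin m) (Fin (m + f)) ℚ}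
    (hB : ∀ i j, B i j = S (Fin.castAdd f i) j) :
    ∃ b : Module.Basis (Fin f) ℤ (integerKernel B),
      ∀ j i, (b j : Fin (m + f) → ℤ) i = S⁻¹ i (Fin.natAdd m j) := by
  let e : integerKernel B ≃ₗ[ℤ] (Fin f → ℤ) :=
    { toFun := fun v j => (S *ᵥ (v : Fin (m + f) → ℤ)) (Fin.natAdd m j)
      map_add' := fun v w => by
        funext j
        simp [Matrix.mulVec_add]
      map_smul' := fun c v => by
        funext j
        exact congrFun (Matrix.mulVec_smul S c (v : Fin (m + f) → ℤ)) _
      invFun := fun w => ⟨S⁻¹ *ᵥ Fin.append 0 w, (mem_integerKernel_iff hB _).mpr fun i => by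
        rw [Matrix.mulVec_mulVec, Matrix.mul_nonsing_inv S hS, Matrix.one_mulVec,
          Fin.append_left, Pi.zero_apply]⟩
      left_inv := fun v => by
        have hv := (mem_integerKernel_iff hB _).mp v.2
        have happ : (Fin.append 0 fun j => (S *ᵥ (v : Fin (m + f) → ℤ)) (Fin.natAdd m j)) =
            S *ᵥ (v : Fin (m + f) → ℤ) := by
          funext k
          refine Fin.addCases (fun i => ?_) (fun i => ?_) k
          · rw [Fin.append_left, hv, Pi.zero_apply]
          · rw [Fin.append_right]
        refine Subtype.ext ?_
        change S⁻¹ *ᵥ _ = _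
        rw [happ, Matrix.mulVec_mulVec, Matrix.nonsing_inv_mul S hS, Matrix.one_mulVec]
      right_inv := fun w => by
        funext j
        change (S *ᵥ (S⁻¹ *ᵥ _)) _ = _
        rw [Matrix.mulVec_mulVec, Matrix.mul_nonsing_inv S hS, Matrix.one_mulVec,
          Fin.append_right] }
  refine ⟨Module.Basis.ofEquivFun e, fun j i => ?_⟩
  rw [Module.Basis.coe_ofEquivFun]
  change (S⁻¹ *ᵥ Fin.append 0 (Pi.single j 1)) i = _
  simp [Matrix.mulVec, dotProduct, Fin.sum_univ_add, Pi.single_apply]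

end BraidVariety

end

theorem mainTheorem3 (r : ℕ) (u : Equiv.Perm (Fin (r + 1))) (β : List (Fin r))
    (hu : ∃ L : List (Fin r), L.Sublist β ∧ BraidVariety.IsReducedWord L u) :
    (∀ i j, ∃ z : ℤ, BraidVariety.extendedExchangeMatrix u β i j = (z : ℚ)) ∧
    IsUnit (BraidVariety.bHat u β).det ∧
    Module.Free ℤ (BraidVariety.integerKernel (BraidVariety.extendedExchangeMatrix u β)) ∧
    Module.finrank ℤ (BraidVariety.integerKernel (BraidVariety.extendedExchangeMatrix u β)) =
      BraidVariety.numFrozen u β ∧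
    ∃ b : Module.Basis (Fin (BraidVariety.numFrozen u β)) ℤ
        (BraidVariety.integerKernel (BraidVariety.extendedExchangeMatrix u β)),
      ∀ (j : Fin (BraidVariety.numFrozen u β))
        (i : Fin (BraidVariety.numMutable u β + BraidVariety.numFrozen u β)),
        (((b j : Fin (BraidVariety.numMutable u β + BraidVariety.numFrozen u β) → ℤ) i : ℤ) : ℚ) =
          BraidVariety.aMatrix u β i (Fin.natAdd (BraidVariety.numMutable u β) j) := by
  set S := (BraidVariety.seifertMatrix u β).submatrix (BraidVariety.vertexEquiv u β)
    (BraidVariety.vertexEquiv u β) with hSdef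
  have hS : IsUnit S.det := by
    rw [hSdef, Matrix.det_submatrix_equiv_self]
    exact BraidVariety.isUnit_det_seifertMatrix u β
  have hbHat : BraidVariety.bHat u β = S.map (Int.castRingHom ℚ) := BraidVariety.bHat_eq u β
  have hB : ∀ i j, BraidVariety.extendedExchangeMatrix u β i j =
      ((S (Fin.castAdd (BraidVariety.numFrozen u β) i) j : ℤ) : ℚ) := fun i j => by
    rw [BraidVariety.extendedExchangeMatrix_eq, hbHat]
    rfl
  have hA : BraidVariety.aMatrix u β = S⁻¹.map (Int.castRingHom ℚ) := by
    refine Matrix.inv_eq_right_inv ?_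
    rw [hbHat, ← Matrix.map_mul, Matrix.mul_nonsing_inv S hS]
    simp
  obtain ⟨b, hb⟩ := BraidVariety.exists_basis_integerKernel hS hB
  refine ⟨fun i j => ⟨_, hB i j⟩, ?_, Module.Free.of_basis b, ?_, b, fun j i => ?_⟩
  · rw [hbHat, ← RingHom.mapMatrix_apply, ← RingHom.map_det]
    exact hS.map _
  · rw [Module.finrank_eq_card_basis b, Fintype.card_fin]
  · rw [hb, hA]
    rfl
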